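/- Fix an alphabet $A$. Transition conditions over a finite set $Q$ and $A$ are the formulas built from atoms $B$ (for $B\subseteq A$) and $\bigcirc q$ (for $q\in Q$) with $\vee$ and $\wedge$. A weak alternating automaton $\mathcal A$ over $A$ consists of a finite state set $Q$, a transition function $\delta$ assigning a transition condition to each $q\in Q$, and a partition of $Q$ into a set $R$ of recurring and a set $N$ of non-recurring states, such that each strongly connected component (SCC) of the transition graph is contained in $R$ or in $N$; the transition graph has vertex set $Q$ and an edge from $q$ to $q'$ iff $\bigcirc q'$ occurs in $\delta(q)$, and SCCs are the classes of mutual reachability by possibly empty paths (so they partition $Q$). $\mathcal A$ is very weak if every SCC is a singleton. A run graph of $\mathcal A$ on $u\in A^\omega$ is a directed graph whose vertices are pairs $\langle i,\tau\rangle$ with $i\in\omega$ and $\tau$ a state or a subformula of some $\delta(q)$, such that for each vertex: $\langle i,q\rangle$ with $q\in Q$ has exactly one outgoing edge, to $\langle i,\delta(q)\rangle$; $\langle i,\bigcirc q\rangle$ has exactly one outgoing edge, to $\langle i+1,q\rangle$; $\langle i,\tau_0\vee\tau_1\rangle$ has at least one outgoing edge, and only to $\langle i,\tau_0\rangle$ or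 $\langle i,\tau_1\rangle$; $\langle i,\tau_0\wedge\tau_1\rangle$ has outgoing edges exactly to $\langle i,\tau_0\rangle$ and $\langle i,\tau_1\rangle$; $\langle i,B\rangle$ has no outgoing edge and is a vertex only if $u(i)\in B$. It is final if on every infinite path all states that occur infinitely often belong to $R$. The suffix $u[i,\omega)$ is accepted from $q$ if $\langle i,q\rangle$ is a vertex of some final run graph on $u$. The function computed by $\mathcal A$ is $f_{\mathcal A}\colon A^\omega\to(2^Q)^\omega$, where $f_{\mathcal A}(u)(i)$ is the set of all $q$ such that $u[i,\omega)$ is accepted from $q$. A backward deterministic automaton $\mathcal B$ with a generalized transition Büchi condition consists of a finite state set $P$, a function $\rho\colon A\times P\to P$, and a finite family of Büchi sets, each a set of transitions $\langle p,a,p'\rangle$ with $p=\rho(a,p')$. A run on $u$ is a word $r\in P^\omega$ with $r(i)=\rho(u(i),r(i+1))$ for all $i$; it is final if for each Büchi set there are infinitely many $i$ with $\langle r(i),u(i),r(i+1)\rangle$ in this set; and it is required that every $u\in A^\omega$ has exactly one final run $r_u$. For an output function $\lambda$ on $P$, the function computed by $\mathcal B$ with respect to $\lambda$ is $f_{\mathcal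 B,\lambda}(u)=\lambda(r_u(0))\,\lambda(r_u(1))\cdots$. **Main Theorem.** For every weak alternating automaton $\mathcal A$ with $n$ states there exist a backward deterministic automaton $\mathcal B$ with a generalized transition Büchi condition and an output function $\lambda\colon P\to 2^Q$ such that $f_{\mathcal A}=f_{\mathcal B,\lambda}$ and all of the following hold. 1. If $S_0,\dots,S_{k-1}$ are the distinct SCCs of the transition graph of $\mathcal A$ and $m_i=|S_i|$, then $\mathcal B$ has at most $\prod_{i<k}(m_i+1)^{m_i}$ states; in particular, it has at most $(n+1)^n$ states. 2. The generalized transition Büchi condition of $\mathcal B$ is a family of exactly $n$ Büchi sets. 3. If $\mathcal A$ is very weak, then $\mathcal B$ has at most $2^n$ states. -/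

import Mathlib

/-- Transition conditions over a state set `Q` and an alphabet `A`: positive boolean combinations
of letter tests `B ⊆ A` and of formulas `◯ q`, `q ∈ Q`. -/
inductive TransCond (A : Type*) (Q : Type*) where
  | letter (B : Set A) : TransCond A Q
  | next (q : Q) : TransCond A Q
  | or (σ τ : TransCond A Q) : TransCond A Q
  | and (σ τ : TransCond A Q) : TransCond A Q

namespace TransCond

/-- The set of subformulas of a transition condition, including the condition itself. -/
def subformulas {A Q : Type*} : TransCond A Q → Set (TransCond A Q)
  | letter B => {letter B}
  | next q => {next q}
  | or σ τ => {or σ τ} ∪ (subformulas σ ∪ subformulas τ)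
  | and σ τ => {and σ τ} ∪ (subformulas σ ∪ subformulas τ)

end TransCond

/-- The data of an alternating automaton: the transition function and the set `R` of recurring
states; the set `N` of non-recurring states is the complement of `R`. -/
structure AlternatingAutomaton (A : Type*) (Q : Type*) where
  δ : Q → TransCond A Q
  R : Set Q

namespace AlternatingAutomaton

/-- The edge relation of the transition graph: `◯ q'` occurs in `δ q`. -/
def TransEdge {A Q : Type*} (M : AlternatingAutomaton A Q) (q q' : Q) : Prop :=
  TransCond.next q' ∈ (M.δ q).subformulas

/-- `q` and `q'` lie in the same strongly connected component of the transition graph: each is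
reachable from the other by a (possibly empty) path. -/
def SameSCC {A Q : Type*} (M : AlternatingAutomaton A Q) (q q' : Q) : Prop :=
  Relation.ReflTransGen M.TransEdge q q' ∧ Relation.ReflTransGen M.TransEdge q' q

open Classical in
/-- The strongly connected component of `q`. -/
noncomputable def scc {A Q : Type*} [Fintype Q] (M : AlternatingAutomaton A Q) (q : Q) :
    Finset Q :=
  Finset.univ.filter (fun q' => M.SameSCC q q')

open Classical in
/-- The finite set of all strongly connected components of the transition graph. -/
noncomputable def sccs {A Q : Type*} [Fintype Q] (M : AlternatingAutomaton A Q) :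
    Finset (Finset Q) :=
  Finset.univ.image M.scc

/-- The automaton is weak: every strongly connected component consists of recurring states only
or of non-recurring states only. -/
def IsWeak {A Q : Type*} [Fintype Q] (M : AlternatingAutomaton A Q) : Prop :=
  ∀ S ∈ M.sccs, (∀ q ∈ S, q ∈ M.R) ∨ (∀ q ∈ S, q ∉ M.R)

/-- The automaton is very weak: every strongly connected component is a singleton. -/
def IsVeryWeak {A Q : Type*} [Fintype Q] (M : AlternatingAutomaton A Q) : Prop :=
  ∀ S ∈ M.sccs, S.card = 1

/-- A run graph of `M` on the word `u`. Vertices are pairs `(i, τ)` where `i` is a position and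
`τ` is a state (`Sum.inl`) or a subformula of some transition condition `δ q` (`Sum.inr`). -/
structure RunGraph {A Q : Type*} (M : AlternatingAutomaton A Q) (u : ℕ → A) where
  verts : Set (ℕ × (Q ⊕ TransCond A Q))
  edge : ℕ × (Q ⊕ TransCond A Q) → ℕ × (Q ⊕ TransCond A Q) → Prop
  edge_verts : ∀ v w, edge v w → v ∈ verts ∧ w ∈ verts
  verts_subformula : ∀ i τ, (i, Sum.inr τ) ∈ verts → ∃ q, τ ∈ (M.δ q).subformulas
  state_edge : ∀ i q, (i, Sum.inl q) ∈ verts →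
    ∀ w, edge (i, Sum.inl q) w ↔ w = (i, Sum.inr (M.δ q))
  next_edge : ∀ i q, (i, Sum.inr (TransCond.next q)) ∈ verts →
    ∀ w, edge (i, Sum.inr (TransCond.next q)) w ↔ w = (i + 1, Sum.inl q)
  or_edge : ∀ i σ τ, (i, Sum.inr (TransCond.or σ τ)) ∈ verts →
    (∀ w, edge (i, Sum.inr (TransCond.or σ τ)) w → w = (i, Sum.inr σ) ∨ w = (i, Sum.inr τ)) ∧
    ∃ w, edge (i, Sum.inr (TransCond.or σ τ)) w
  and_edge : ∀ i σ τ, (i, Sum.inr (TransCond.and σ τ)) ∈ verts →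
    ∀ w, edge (i, Sum.inr (TransCond.and σ τ)) w ↔ w = (i, Sum.inr σ) ∨ w = (i, Sum.inr τ)
  letter_edge : ∀ i B w, ¬ edge (i, Sum.inr (TransCond.letter B)) w
  letter_mem : ∀ i B, (i, Sum.inr (TransCond.letter B)) ∈ verts → u i ∈ B

/-- A run graph is final if, on every infinite path through it, every state that occurs
infinitely often is recurring. -/
def RunGraph.IsFinal {A Q : Type*} {M : AlternatingAutomaton A Q} {u : ℕ → A}
    (G : M.RunGraph u) : Prop :=
  ∀ π : ℕ → ℕ × (Q ⊕ TransCond A Q), (∀ k, G.edge (π k) (π (k + 1))) →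
    {q : Q | {k | (π k).2 = Sum.inl q}.Infinite} ⊆ M.R

/-- The suffix `u[i,ω)` is accepted by `M` from the state `q`. -/
def Accepts {A Q : Type*} (M : AlternatingAutomaton A Q) (u : ℕ → A) (i : ℕ) (q : Q) : Prop :=
  ∃ G : M.RunGraph u, G.IsFinal ∧ (i, Sum.inl q) ∈ G.verts

/-- The function computed by `M`, from words over `A` to words over the power set of `Q`. -/
def computed {A Q : Type*} (M : AlternatingAutomaton A Q) : (ℕ → A) → ℕ → Set Q :=
  fun u i => {q | M.Accepts u i q}

end AlternatingAutomaton

/-- The data of a backward automaton with a generalized transition Büchi condition: a transition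
function `ρ` and a finite family of Büchi sets. A transition is a triple `(p, a, p')` with
`p = ρ a p'`. -/
structure BackwardGTBAutomaton (A : Type*) (P : Type*) where
  ρ : A → P → P
  numBuchi : ℕ
  buchi : Fin numBuchi → Set (P × A × P)
  buchi_transition : ∀ j p a p', (p, a, p') ∈ buchi j → p = ρ a p'

namespace BackwardGTBAutomaton

/-- `r` is a run on `u`. -/
def IsRun {A P : Type*} (B : BackwardGTBAutomaton A P) (u : ℕ → A) (r : ℕ → P) : Prop :=
  ∀ i, r i = B.ρ (u i) (r (i + 1))

/-- `r` is a final run on `u`: transitions from each of the Büchi sets are taken infinitely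
often. -/
def IsFinalRun {A P : Type*} (B : BackwardGTBAutomaton A P) (u : ℕ → A) (r : ℕ → P) : Prop :=
  B.IsRun u r ∧ ∀ j, {i | (r i, u i, r (i + 1)) ∈ B.buchi j}.Infinite

end BackwardGTBAutomaton

/-- A backward deterministic automaton with a generalized transition Büchi condition: every
infinite word has exactly one final run. -/
structure BackwardDetGTBAutomaton (A : Type*) (P : Type*) extends BackwardGTBAutomaton A P where
  existsUnique_finalRun : ∀ u : ℕ → A, ∃! r : ℕ → P, toBackwardGTBAutomaton.IsFinalRun u r

namespace BackwardDetGTBAutomaton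

/-- The unique final run on `u`. -/
noncomputable def finalRun {A P : Type*} (B : BackwardDetGTBAutomaton A P) (u : ℕ → A) : ℕ → P :=
  (B.existsUnique_finalRun u).choose

/-- The function computed with respect to the output function `out`. -/
noncomputable def computed {A P C : Type*} (B : BackwardDetGTBAutomaton A P) (out : P → C) :
    (ℕ → A) → ℕ → C :=
  fun u i => out (B.finalRun u i)

end BackwardDetGTBAutomaton

/-! ### Transition conditions: satisfaction, duality, continuity. -/

namespace TransCond

variable {A Q : Type*}

/-! Give each state a default status: accepted if recurring, rejected if not. Within one strongly
connected component, the states that leave the default form a least fixed point whose inputs are the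
statuses in lower components. Its stages are `attr`, and by continuity of positive conditions
(`Sat.exists_of_iUnion`) the finite stages suffice. Solutions `Z` of these nested equations exist by
induction on `height`. Every solution is the computed function (`IsSolution.eq_computed`): the
stages provide a measure witnessing acceptance from each state of `Z i`, the same argument for the
dual automaton covers the complement, and no state is accepted by both.

The backward automaton guesses, for each state, the rank within its component of the round in which
it leaves the default: level zero means never, and higher levels mean earlier rounds. Only the
relative order is stored, so a component of size `m` needs at most the levels `0, ..., m`, which
gives the factor `(m + 1) ^ m`. Read backwards, a letter determines the new order: a state gets as
`rawLevel` the largest threshold whose upper set of states suffices to leave the default, and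
`levelIndex` closes the gaps.

A run of levels could fail to be correct only by claiming that some state leaves the default
although it never does. Such a false claim at the maximal level reproduces itself forever with raw
level equal to level, and the Büchi sets forbid exactly this (`IsLevelRun.isSolution`). Once the
claims are correct, the levels are forced (`IsLevelRun.eq_levelIndex`); conversely the true levels
never persist in this way (`IsSolution.isLevelRun`). One condition per component and positive level
amounts to one Büchi set per state. -/

/-- Satisfaction of a transition condition by a letter and a set of states. -/
def Sat (a : A) (X : Set Q) : TransCond A Q → Prop
  | letter B => a ∈ B
  | next q => q ∈ X
  | or σ τ => Sat a X σ ∨ Sat a X τ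
  | and σ τ => Sat a X σ ∧ Sat a X τ

/-- The dual transition condition. -/
def dual : TransCond A Q → TransCond A Q
  | letter B => letter Bᶜ
  | next q => next q
  | or σ τ => and (dual σ) (dual τ)
  | and σ τ => or (dual σ) (dual τ)

/-- The number of connectives and atoms of a transition condition. -/
def size : TransCond A Q → ℕ
  | letter _ => 1
  | next _ => 1
  | or σ τ => size σ + size τ + 1
  | and σ τ => size σ + size τ + 1

theorem dual_dual (τ : TransCond A Q) : τ.dual.dual = τ := by
  induction τ <;> simp_all [dual]

theorem mem_subformulas_self (τ : TransCond A Q) : τ ∈ τ.subformulas := by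
  cases τ <;> simp [subformulas]

theorem subformulas_trans {ρ σ τ : TransCond A Q} (h₁ : ρ ∈ σ.subformulas)
    (h₂ : σ ∈ τ.subformulas) : ρ ∈ τ.subformulas := by
  induction τ with
  | letter B => simp only [subformulas, Set.mem_singleton_iff] at h₂; subst h₂; exact h₁
  | next q => simp only [subformulas, Set.mem_singleton_iff] at h₂; subst h₂; exact h₁
  | or α β iα iβ =>
    rcases h₂ with h₂ | h₂ | h₂
    · rw [Set.mem_singleton_iff] at h₂; subst h₂; exact h₁
    · exact Or.inr (Or.inl (iα h₂))
    · exact Or.inr (Or.inr (iβ h₂))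
  | and α β iα iβ =>
    rcases h₂ with h₂ | h₂ | h₂
    · rw [Set.mem_singleton_iff] at h₂; subst h₂; exact h₁
    · exact Or.inr (Or.inl (iα h₂))
    · exact Or.inr (Or.inr (iβ h₂))

theorem left_mem_subformulas_or (σ τ : TransCond A Q) : σ ∈ (or σ τ).subformulas :=
  Or.inr (Or.inl (mem_subformulas_self σ))

theorem right_mem_subformulas_or (σ τ : TransCond A Q) : τ ∈ (or σ τ).subformulas :=
  Or.inr (Or.inr (mem_subformulas_self τ))

theorem left_mem_subformulas_and (σ τ : TransCond A Q) : σ ∈ (and σ τ).subformulas :=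
  Or.inr (Or.inl (mem_subformulas_self σ))

theorem right_mem_subformulas_and (σ τ : TransCond A Q) : τ ∈ (and σ τ).subformulas :=
  Or.inr (Or.inr (mem_subformulas_self τ))

theorem next_mem_subformulas_dual {q : Q} {τ : TransCond A Q} :
    next q ∈ τ.dual.subformulas ↔ next q ∈ τ.subformulas := by
  induction τ <;> simp_all [dual, subformulas]

/-- Restricting monotonicity to occurring atoms brings in edges of the transition graph, along which
`height` can be compared. -/
theorem Sat.mono_of_next_mem {a : A} {X Y : Set Q} {τ : TransCond A Q} (hs : τ.Sat a X)
    (h : ∀ q, next q ∈ τ.subformulas → q ∈ X → q ∈ Y) : τ.Sat a Y := by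
  induction τ with
  | letter B => exact hs
  | next q => exact h q rfl hs
  | or α β iα iβ =>
    rcases hs with hs | hs
    · exact Or.inl (iα hs fun q hq => h q (Or.inr (Or.inl hq)))
    · exact Or.inr (iβ hs fun q hq => h q (Or.inr (Or.inr hq)))
  | and α β iα iβ =>
    exact ⟨iα hs.1 fun q hq => h q (Or.inr (Or.inl hq)),
      iβ hs.2 fun q hq => h q (Or.inr (Or.inr hq))⟩

theorem Sat.mono {a : A} {X Y : Set Q} {τ : TransCond A Q} (hs : τ.Sat a X) (h : X ⊆ Y) :
    τ.Sat a Y :=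
  hs.mono_of_next_mem fun _ _ hq => h hq

theorem sat_dual {a : A} {X : Set Q} {τ : TransCond A Q} : τ.dual.Sat a X ↔ ¬ τ.Sat a Xᶜ := by
  induction τ <;> (simp_all [dual, Sat]; try tauto)

/-- A condition has finitely many atoms, so one stage of an increasing chain contains all those
needed. This is why the fixed points close after ω rounds. -/
theorem Sat.exists_of_iUnion {a : A} {V : ℕ → Set Q} (hV : Monotone V) {τ : TransCond A Q}
    (hs : τ.Sat a (⋃ k, V k)) : ∃ k, τ.Sat a (V k) := by
  induction τ with
  | letter B => exact ⟨0, hs⟩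
  | next q => exact Set.mem_iUnion.1 hs
  | or α β iα iβ =>
    rcases hs with hs | hs
    · exact (iα hs).imp fun _ => Or.inl
    · exact (iβ hs).imp fun _ => Or.inr
  | and α β iα iβ =>
    obtain ⟨k, hk⟩ := iα hs.1
    obtain ⟨l, hl⟩ := iβ hs.2
    exact ⟨max k l, hk.mono (hV (le_max_left _ _)), hl.mono (hV (le_max_right _ _))⟩

end TransCond

/-! ### Acceptance from a well-founded measure. -/

namespace AlternatingAutomaton

variable {A Q : Type*}

section Measure

variable (M : AlternatingAutomaton A Q) (u : ℕ → A) {W : Type*} [LinearOrder W]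
  (X : ℕ → Set Q) (μ : ℕ → Q → W)

/-- The vertices of the run graph determined by a family of sets of states. -/
def measureVerts : Set (ℕ × (Q ⊕ TransCond A Q)) :=
  {v | match v with
    | (i, Sum.inl q) => q ∈ X i
    | (i, Sum.inr τ) => (∃ q, τ ∈ (M.δ q).subformulas) ∧ τ.Sat (u i) (X (i + 1))}

/-- The measure of the vertex is less than `w`. -/
def MeasureLT (w : W) : ℕ × (Q ⊕ TransCond A Q) → Prop
  | (i, Sum.inl q) => μ i q < w
  | (i, Sum.inr τ) => τ.Sat (u i) {q | q ∈ X (i + 1) ∧ μ (i + 1) q < w}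

/-- The edges of the run graph in which disjunctions are resolved by minimal measure. -/
def MeasureEdge : ℕ × (Q ⊕ TransCond A Q) → ℕ × (Q ⊕ TransCond A Q) → Prop
  | (i, Sum.inl q), w => w = (i, Sum.inr (M.δ q))
  | (_, Sum.inr (TransCond.letter _)), _ => False
  | (i, Sum.inr (TransCond.next q)), w => w = (i + 1, Sum.inl q)
  | (i, Sum.inr (TransCond.or σ τ)), w => (w = (i, Sum.inr σ) ∨ w = (i, Sum.inr τ)) ∧
      ∀ x, MeasureLT u X μ x (i, Sum.inr (TransCond.or σ τ)) → MeasureLT u X μ x w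
  | (i, Sum.inr (TransCond.and σ τ)), w => w = (i, Sum.inr σ) ∨ w = (i, Sum.inr τ)

variable {M u X μ}

theorem MeasureLT.total {i : ℕ} (σ τ : TransCond A Q) :
    (∀ x, MeasureLT u X μ x (i, Sum.inr σ) → MeasureLT u X μ x (i, Sum.inr τ)) ∨
    (∀ x, MeasureLT u X μ x (i, Sum.inr τ) → MeasureLT u X μ x (i, Sum.inr σ)) := by
  by_contra! h
  obtain ⟨⟨x, hx, hx'⟩, ⟨y, hy, hy'⟩⟩ := h
  rcases le_total x y with hxy | hxy
  · exact hy' (TransCond.Sat.mono hx fun q hq => ⟨hq.1, hq.2.trans_le hxy⟩)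
  · exact hx' (TransCond.Sat.mono hy fun q hq => ⟨hq.1, hq.2.trans_le hxy⟩)

/-- The run graph in which disjunctions are resolved by minimal measure. -/
def measureGraph (h : ∀ i, ∀ q ∈ X i, (M.δ q).Sat (u i) (X (i + 1))) : M.RunGraph u where
  verts := measureVerts M u X
  edge v w := v ∈ measureVerts M u X ∧ w ∈ measureVerts M u X ∧ MeasureEdge M u X μ v w
  edge_verts v w hvw := ⟨hvw.1, hvw.2.1⟩
  verts_subformula i τ hτ := hτ.1
  state_edge i q hq w := by
    refine ⟨fun hw => hw.2.2, ?_⟩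
    rintro rfl
    exact ⟨hq, ⟨⟨q, TransCond.mem_subformulas_self _⟩, h i q hq⟩, rfl⟩
  next_edge i q hq w := by
    refine ⟨fun hw => hw.2.2, ?_⟩
    rintro rfl
    exact ⟨hq, hq.2, rfl⟩
  or_edge i σ τ hv := by
    refine ⟨fun w hw => hw.2.2.1, ?_⟩
    obtain ⟨⟨q, hq⟩, hs⟩ := id hv
    have hσ := TransCond.subformulas_trans (TransCond.left_mem_subformulas_or σ τ) hq
    have hτ := TransCond.subformulas_trans (TransCond.right_mem_subformulas_or σ τ) hq
    have hX : ∀ {ρ : TransCond A Q} {x}, MeasureLT u X μ x (i, Sum.inr ρ) →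
        ρ.Sat (u i) (X (i + 1)) := fun hx => TransCond.Sat.mono hx fun q hq => hq.1
    -- Satisfaction must be required separately: a satisfied disjunct may have no strict upper bound
    -- in `W`, so comparing bounds alone could select an unsatisfied one.
    by_cases h₁ : σ.Sat (u i) (X (i + 1)) ∧
        ∀ x, MeasureLT u X μ x (i, Sum.inr τ) → MeasureLT u X μ x (i, Sum.inr σ)
    · exact ⟨(i, Sum.inr σ), hv, ⟨⟨q, hσ⟩, h₁.1⟩, Or.inl rfl, fun x hx => hx.elim id (h₁.2 x)⟩
    · have h₂ : ∀ x, MeasureLT u X μ x (i, Sum.inr σ) → MeasureLT u X μ x (i, Sum.inr τ) := by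
        intro x hx
        exact ((MeasureLT.total σ τ).resolve_right fun h' => h₁ ⟨hX hx, h'⟩) x hx
      have h₃ : τ.Sat (u i) (X (i + 1)) := by
        by_contra hn
        exact h₁ ⟨hs.resolve_right hn, fun x hx => (hn (hX hx)).elim⟩
      exact ⟨(i, Sum.inr τ), hv, ⟨⟨q, hτ⟩, h₃⟩, Or.inr rfl, fun x hx => hx.elim (h₂ x) id⟩
  and_edge i σ τ hv w := by
    refine ⟨fun hw => hw.2.2, ?_⟩
    obtain ⟨⟨q, hq⟩, hs⟩ := id hv
    rintro (rfl | rfl)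
    · exact ⟨hv, ⟨⟨q, TransCond.subformulas_trans
        (TransCond.left_mem_subformulas_and σ τ) hq⟩, hs.1⟩, Or.inl rfl⟩
    · exact ⟨hv, ⟨⟨q, TransCond.subformulas_trans
        (TransCond.right_mem_subformulas_and σ τ) hq⟩, hs.2⟩, Or.inr rfl⟩
  letter_edge i B w hw := hw.2.2
  letter_mem i B hB := hB.2

/-- States are accepted if they carry a well-founded measure that does not increase along the
transitions and decreases at non-recurring states. -/
theorem accepts_of_measure [WellFoundedLT W]
    (hR : ∀ i, ∀ q ∈ X i, (M.δ q).Sat (u i) {q' | q' ∈ X (i + 1) ∧ μ (i + 1) q' ≤ μ i q})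
    (hN : ∀ i, ∀ q ∈ X i, q ∉ M.R →
      (M.δ q).Sat (u i) {q' | q' ∈ X (i + 1) ∧ μ (i + 1) q' < μ i q})
    {i : ℕ} {q : Q} (hq : q ∈ X i) : M.Accepts u i q := by
  refine ⟨measureGraph (μ := μ) fun i q hq => (hR i q hq).mono fun _ h => h.1, ?_, hq⟩
  intro π hπ q hinf
  by_contra hqR
  -- Strict upper bounds on the measure are inherited along the path.
  have step : ∀ x k, MeasureLT u X μ x (π k) → MeasureLT u X μ x (π (k + 1)) := by
    intro x k hx
    obtain ⟨hv, -, he⟩ := hπ k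
    generalize π k = v at *
    generalize π (k + 1) = w at *
    match v, hv, he, hx with
    | (i, Sum.inl q), hv, he, hx =>
      rw [show w = _ from he]
      exact (hR i q hv).mono fun q' hq' => ⟨hq'.1, hq'.2.trans_lt hx⟩
    | (i, Sum.inr (TransCond.next q)), hv, he, hx =>
      rw [show w = _ from he]
      exact hx.2
    | (i, Sum.inr (TransCond.or σ τ)), hv, he, hx => exact he.2 x hx
    | (i, Sum.inr (TransCond.and σ τ)), hv, he, hx =>
      rcases he with rfl | rfl
      · exact hx.1
      · exact hx.2
  have steps : ∀ x k l, MeasureLT u X μ x (π k) → MeasureLT u X μ x (π (k + l)) := by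
    intro x k l hx
    induction l with
    | zero => exact hx
    | succ l ih => exact step x _ ih
  -- At the visit to `q` of least measure, non-recurrence forces a strict decrease, which persists
  -- to the next visit and contradicts minimality.
  obtain ⟨w, ⟨k, hk, rfl⟩, hmin⟩ := (wellFounded_lt (α := W)).has_min
    ((fun k => μ (π k).1 q) '' {k | (π k).2 = Sum.inl q}) (hinf.nonempty.image _)
  have hπk : π k = ((π k).1, Sum.inl q) := Prod.ext rfl hk
  have hk1 : MeasureLT u X μ (μ (π k).1 q) (π (k + 1)) := by
    obtain ⟨hv, -, he⟩ := hπ k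
    rw [hπk] at hv he
    rw [show π (k + 1) = _ from he]
    exact hN _ q hv hqR
  obtain ⟨l, hl, hkl⟩ := hinf.exists_gt k
  obtain ⟨d, rfl⟩ := Nat.exists_eq_add_of_lt hkl
  have := steps _ _ d hk1
  rw [show k + 1 + d = k + d + 1 by ring, show π (k + d + 1) = ((π (k + d + 1)).1, Sum.inl q) from
    Prod.ext rfl hl] at this
  exact hmin _ ⟨_, hl, rfl⟩ this

end Measure

/-! ### The dual automaton and disjointness of acceptance. -/

/-- The dual automaton. -/
def dual (M : AlternatingAutomaton A Q) : AlternatingAutomaton A Q where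
  δ q := (M.δ q).dual
  R := M.Rᶜ

/-- Between visits to states the formulas shrink, so an infinite path cannot avoid states. -/
theorem RunGraph.exists_state_visit {M : AlternatingAutomaton A Q} {u : ℕ → A} (G : M.RunGraph u)
    {π : ℕ → ℕ × (Q ⊕ TransCond A Q)} (hπ : ∀ k, G.edge (π k) (π (k + 1))) (k : ℕ) :
    ∃ l, k ≤ l ∧ ∃ q, (π l).2 = Sum.inl q := by
  suffices H : ∀ n k τ, τ.size ≤ n → (π k).2 = Sum.inr τ →
      ∃ l, k ≤ l ∧ ∃ q, (π l).2 = Sum.inl q by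
    rcases h : (π k).2 with q | τ
    · exact ⟨k, le_rfl, q, h⟩
    · exact H _ k τ le_rfl h
  intro n
  induction n with
  | zero => intro k τ hτ; cases τ <;> simp [TransCond.size] at hτ
  | succ n ih =>
    intro k τ hτ hk
    have he := hπ k
    have hv := (G.edge_verts _ _ he).1
    rw [show π k = ((π k).1, Sum.inr τ) from Prod.ext rfl hk] at he hv
    have key : ∀ σ : TransCond A Q, σ.size ≤ n → π (k + 1) = ((π k).1, Sum.inr σ) →
        ∃ l, k ≤ l ∧ ∃ q, (π l).2 = Sum.inl q := by
      intro σ hσ h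
      obtain ⟨l, hl, h⟩ := ih (k + 1) σ hσ (by rw [h])
      exact ⟨l, by omega, h⟩
    cases τ with
    | letter B => exact (G.letter_edge _ _ _ he).elim
    | next q => exact ⟨k + 1, by omega, q, by rw [(G.next_edge _ _ hv _).1 he]⟩
    | or σ τ =>
      simp only [TransCond.size] at hτ
      rcases (G.or_edge _ _ _ hv).1 _ he with h | h
      · exact key σ (by omega) h
      · exact key τ (by omega) h
    | and σ τ =>
      simp only [TransCond.size] at hτ
      rcases (G.and_edge _ _ _ hv _).1 he with h | h
      · exact key σ (by omega) h
      · exact key τ (by omega) h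

/-- The vertex of the dual automaton corresponding to a vertex. -/
def dualVertex : ℕ × (Q ⊕ TransCond A Q) → ℕ × (Q ⊕ TransCond A Q) :=
  Prod.map id (Sum.map id TransCond.dual)

/-- Two final run graphs, played against each other, share an infinite path: each resolves the
disjunctions that are conjunctions for the other, and a letter test cannot hold together with its
complement. A state visited infinitely often would be both recurring and non-recurring. -/
theorem not_accepts_dual [Finite Q] {M : AlternatingAutomaton A Q} {u : ℕ → A} {i : ℕ} {q : Q}
    (h : M.Accepts u i q) : ¬ M.dual.Accepts u i q := by
  rintro ⟨G', hG', hq'⟩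
  obtain ⟨G, hG, hq⟩ := h
  have step : ∀ v : {v // v ∈ G.verts ∧ dualVertex v ∈ G'.verts},
      ∃ w : {v // v ∈ G.verts ∧ dualVertex v ∈ G'.verts},
        G.edge v.1 w.1 ∧ G'.edge (dualVertex v.1) (dualVertex w.1) := by
    rintro ⟨v, hv, hv'⟩
    suffices ∃ w, G.edge v w ∧ G'.edge (dualVertex v) (dualVertex w) by
      obtain ⟨w, h₁, h₂⟩ := this
      exact ⟨⟨w, (G.edge_verts _ _ h₁).2, (G'.edge_verts _ _ h₂).2⟩, h₁, h₂⟩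
    match v, hv, hv' with
    | (i, Sum.inl q), hv, hv' =>
      exact ⟨_, (G.state_edge i q hv _).2 rfl, (G'.state_edge i q hv' _).2 rfl⟩
    | (i, Sum.inr (TransCond.letter B)), hv, hv' =>
      exact (G'.letter_mem i _ hv' (G.letter_mem i _ hv)).elim
    | (i, Sum.inr (TransCond.next q)), hv, hv' =>
      exact ⟨_, (G.next_edge i q hv _).2 rfl, (G'.next_edge i q hv' _).2 rfl⟩
    | (i, Sum.inr (TransCond.or σ τ)), hv, hv' =>
      obtain ⟨h, w, hw⟩ := G.or_edge i σ τ hv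
      refine ⟨w, hw, (G'.and_edge i σ.dual τ.dual hv' _).2 ?_⟩
      rcases h w hw with rfl | rfl
      · exact Or.inl rfl
      · exact Or.inr rfl
    | (i, Sum.inr (TransCond.and σ τ)), hv, hv' =>
      obtain ⟨h, w, hw⟩ := G'.or_edge i σ.dual τ.dual hv'
      rcases h w hw with rfl | rfl
      · exact ⟨_, (G.and_edge i σ τ hv _).2 (Or.inl rfl), hw⟩
      · exact ⟨_, (G.and_edge i σ τ hv _).2 (Or.inr rfl), hw⟩
  choose f hf using step
  let π : ℕ → {v // v ∈ G.verts ∧ dualVertex v ∈ G'.verts} :=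
    fun k => f^[k] ⟨(i, Sum.inl q), hq, hq'⟩
  have hπ : ∀ k, G.edge (π k).1 (π (k + 1)).1 ∧
      G'.edge (dualVertex (π k).1) (dualVertex (π (k + 1)).1) := by
    intro k
    simp only [π, Function.iterate_succ_apply']
    exact hf _
  have hinf : {k | ∃ q, (π k).1.2 = Sum.inl q}.Infinite := by
    refine Set.infinite_of_forall_exists_gt fun k => ?_
    obtain ⟨l, hl, h⟩ := G.exists_state_visit (π := fun k => (π k).1) (fun k => (hπ k).1) (k + 1)
    exact ⟨l, h, by omega⟩
  obtain ⟨q₀, hq₀⟩ : ∃ q, {k | (π k).1.2 = Sum.inl q}.Infinite := by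
    by_contra! hfin
    refine hinf ((Set.finite_iUnion hfin).subset fun k hk => ?_)
    simpa using hk
  refine hG' (fun k => dualVertex (π k).1) (fun k => (hπ k).2)
    (show q₀ ∈ _ from hq₀.mono fun k hk => ?_) (hG (fun k => (π k).1) (fun k => (hπ k).1) hq₀)
  simp only [Set.mem_ofPred_eq] at hk ⊢
  simp [dualVertex, hk]

end AlternatingAutomaton

/-! ### Components, attractors and the nested fixed point equations. -/

namespace AlternatingAutomaton

variable {A Q : Type*}

theorem SameSCC.refl (M : AlternatingAutomaton A Q) (q : Q) : M.SameSCC q q :=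
  ⟨.refl, .refl⟩

theorem SameSCC.symm {M : AlternatingAutomaton A Q} {q q' : Q} (h : M.SameSCC q q') :
    M.SameSCC q' q :=
  ⟨h.2, h.1⟩

theorem SameSCC.trans {M : AlternatingAutomaton A Q} {q q' q'' : Q} (h : M.SameSCC q q')
    (h' : M.SameSCC q' q'') : M.SameSCC q q'' :=
  ⟨h.1.trans h'.1, h'.2.trans h.2⟩

theorem SameSCC.congr_left {M : AlternatingAutomaton A Q} {q q' q'' : Q} (h : M.SameSCC q q') :
    M.SameSCC q q'' ↔ M.SameSCC q' q'' :=
  ⟨h.symm.trans, h.trans⟩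

section Height

variable [Fintype Q] (M : AlternatingAutomaton A Q)

open Classical in
/-- The number of states reachable from `q`. -/
noncomputable def height (q : Q) : ℕ :=
  (Finset.univ.filter fun q' => Relation.ReflTransGen M.TransEdge q q').card

variable {M}

theorem height_le {q q' : Q} (h : M.TransEdge q q') : M.height q' ≤ M.height q := by
  classical
  refine Finset.card_le_card fun x hx => ?_
  simp only [Finset.mem_filter, Finset.mem_univ, true_and] at hx ⊢
  exact .head h hx

theorem height_lt {q q' : Q} (h : M.TransEdge q q') (hn : ¬ M.SameSCC q q') :
    M.height q' < M.height q := by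
  classical
  refine Finset.card_lt_card ⟨fun x hx => ?_, fun hsub => ?_⟩
  · simp only [Finset.mem_filter, Finset.mem_univ, true_and] at hx ⊢
    exact .head h hx
  · have := @hsub q (by simp [Relation.ReflTransGen.refl])
    simp only [Finset.mem_filter, Finset.mem_univ, true_and] at this
    exact hn ⟨.single h, this⟩

end Height

section Attractor

variable (M : AlternatingAutomaton A Q)

open Classical in
/-- The transition condition of `q` from the point of view of leaving the default status, which is
rejection for non-recurring states and acceptance for recurring states. -/
noncomputable def polarized (q : Q) : TransCond A Q :=
  if q ∈ M.R then (M.δ q).dual else M.δ q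

/-- Relative to `q`, combine the set `V` on the strongly connected component of `q` with the set
`X` of accepted states elsewhere, complemented if `q` is recurring. -/
def relSet (q : Q) (X V : Set Q) : Set Q :=
  {q' | (M.SameSCC q q' ∧ q' ∈ V) ∨ (¬ M.SameSCC q q' ∧ (q' ∈ X ↔ q ∉ M.R))}

/-- The states that leave their default status within `k` rounds, given the status `Z` of the
states in other strongly connected components. -/
def attr (u : ℕ → A) (Z : ℕ → Set Q) : ℕ → ℕ → Set Q
  | 0, _ => ∅
  | k + 1, i =>
    {q | (M.polarized q).Sat (u i) (M.relSet q (Z (i + 1)) (attr u Z k (i + 1)))}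

/-- `Z` solves the nested fixed point equations of `M` on `u`. -/
def IsSolution (u : ℕ → A) (Z : ℕ → Set Q) : Prop :=
  ∀ i q, (q ∈ Z i ↔ q ∉ M.R) ↔ ∃ k, q ∈ M.attr u Z k i

variable {M}

theorem polarized_of_mem {q : Q} (h : q ∈ M.R) : M.polarized q = (M.δ q).dual := if_pos h

theorem polarized_of_notMem {q : Q} (h : q ∉ M.R) : M.polarized q = M.δ q := if_neg h

theorem next_mem_polarized {q q' : Q} :
    TransCond.next q' ∈ (M.polarized q).subformulas ↔ M.TransEdge q q' := by
  unfold polarized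
  split_ifs
  · exact TransCond.next_mem_subformulas_dual
  · rfl

theorem relSet_mono {q : Q} {X V V' : Set Q} (h : ∀ q', M.SameSCC q q' → q' ∈ V → q' ∈ V') :
    M.relSet q X V ⊆ M.relSet q X V' :=
  fun q' hq' => hq'.imp (fun hq' => ⟨hq'.1, h q' hq'.1 hq'.2⟩) id

theorem attr_succ_mono {u : ℕ → A} {Z : ℕ → Set Q} (k i : ℕ) :
    M.attr u Z k i ⊆ M.attr u Z (k + 1) i := by
  induction k generalizing i with
  | zero => exact Set.empty_subset _
  | succ k ih =>
    exact fun q hq => TransCond.Sat.mono hq (relSet_mono fun q' _ h => ih _ h)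

theorem attr_mono {u : ℕ → A} {Z : ℕ → Set Q} (i : ℕ) : Monotone fun k => M.attr u Z k i :=
  monotone_nat_of_le_succ fun k => attr_succ_mono k i

variable (M) in
/-- The set of states encoded by an assignment of levels. -/
def decode (p : Q → ℕ) : Set Q := {q | p q ≠ 0 ↔ q ∉ M.R}

theorem mem_decode_iff {p : Q → ℕ} {q : Q} : (q ∈ M.decode p ↔ q ∉ M.R) ↔ p q ≠ 0 := by
  simp only [decode, Set.mem_ofPred_eq]
  tauto

variable (M) in
/-- The set of numbers of rounds in which `q` leaves its default status. -/
def attrTimes (u : ℕ → A) (Z : ℕ → Set Q) (i : ℕ) (q : Q) : Set ℕ := {k | q ∈ M.attr u Z k i}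

theorem attrTimes_total (u : ℕ → A) (Z : ℕ → Set Q) (i : ℕ) (x y : Q) :
    M.attrTimes u Z i x ≤ M.attrTimes u Z i y ∨ M.attrTimes u Z i y ≤ M.attrTimes u Z i x := by
  by_contra! h
  obtain ⟨h₁, h₂⟩ := h
  obtain ⟨k, hk, hk'⟩ := Set.not_subset.1 h₁
  obtain ⟨l, hl, hl'⟩ := Set.not_subset.1 h₂
  rcases le_total k l with hkl | hkl
  · exact hl' (attr_mono i hkl hk)
  · exact hk' (attr_mono i hkl hl)

theorem attrTimes_eq_bot {u : ℕ → A} {Z : ℕ → Set Q} {i : ℕ} {q : Q} :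
    M.attrTimes u Z i q = ⊥ ↔ ¬ ∃ k, q ∈ M.attr u Z k i := by
  rw [Set.bot_eq_empty, Set.eq_empty_iff_forall_notMem, not_exists]
  rfl

theorem mem_dual_R {q : Q} : q ∈ M.dual.R ↔ q ∉ M.R := Iff.rfl

theorem sameSCC_dual {q q' : Q} : M.dual.SameSCC q q' ↔ M.SameSCC q q' := by
  have : M.dual.TransEdge = M.TransEdge := by
    funext q q'
    exact propext TransCond.next_mem_subformulas_dual
  simp only [SameSCC, this]

theorem mem_relSet_dual {q q' : Q} {X V : Set Q} :
    q' ∈ M.dual.relSet q Xᶜ V ↔ q' ∈ M.relSet q X V := by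
  simp only [relSet, sameSCC_dual, mem_dual_R, Set.mem_ofPred_eq, Set.mem_compl_iff]
  tauto

/-- Dualizing swaps the default statuses together with the meaning of `Z`, so leaving the default is
the same event. -/
theorem attr_dual {u : ℕ → A} {Z : ℕ → Set Q} (k i : ℕ) :
    M.dual.attr u (fun i => (Z i)ᶜ) k i = M.attr u Z k i := by
  induction k generalizing i with
  | zero => rfl
  | succ k ih =>
    have hp : ∀ q, M.dual.polarized q = M.polarized q := by
      intro q
      by_cases hq : q ∈ M.R
      · rw [polarized_of_mem hq, polarized_of_notMem (by simpa [dual] using hq)]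
        rfl
      · rw [polarized_of_notMem hq, polarized_of_mem (by simpa [dual] using hq)]
        exact TransCond.dual_dual _
    have hr : ∀ q X V, M.dual.relSet q Xᶜ V = M.relSet q X V :=
      fun _ _ _ => Set.ext fun _ => mem_relSet_dual
    ext q
    simp only [attr, Set.mem_ofPred_eq, hp, ih, hr]

theorem IsSolution.dual {u : ℕ → A} {Z : ℕ → Set Q} (h : M.IsSolution u Z) :
    M.dual.IsSolution u fun i => (Z i)ᶜ := by
  intro i q
  simp only [attr_dual, ← h i q, mem_dual_R, Set.mem_compl_iff]
  tauto

theorem IsWeak.mem_R_iff [Fintype Q] (hM : M.IsWeak) {q q' : Q} (h : M.SameSCC q q') :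
    q ∈ M.R ↔ q' ∈ M.R := by
  classical
  have hq : q ∈ M.scc q := by simp [scc, SameSCC.refl]
  have hq' : q' ∈ M.scc q := by simp [scc, h]
  rcases hM (M.scc q) (Finset.mem_image_of_mem _ (Finset.mem_univ q)) with h | h
  · simp [h q hq, h q' hq']
  · simp [h q hq, h q' hq']

/-- If the condition failed, its dual would hold on the complement. By continuity a single stage `k`
would suffice for this, so `q` would leave its default at stage `k + 1`. -/
theorem IsSolution.sat [Fintype Q] (hw : ∀ q q', M.SameSCC q q' → (q ∈ M.R ↔ q' ∈ M.R))
    {u : ℕ → A} {Z : ℕ → Set Q} (h : M.IsSolution u Z) {i : ℕ} {q : Q} (hq : q ∈ Z i)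
    (hR : q ∈ M.R) : (M.δ q).Sat (u i) (Z (i + 1)) := by
  by_contra hn
  have h₁ : (M.polarized q).Sat (u i) (⋃ k, M.relSet q (Z (i + 1)) (M.attr u Z k (i + 1))) := by
    rw [polarized_of_mem hR]
    rw [← compl_compl (Z (i + 1)), ← TransCond.sat_dual] at hn
    refine hn.mono fun q' hq' => ?_
    rw [Set.mem_compl_iff] at hq'
    by_cases hs : M.SameSCC q q'
    · obtain ⟨k, hk⟩ := (h (i + 1) q').1 (by simp [hq', ← hw q q' hs, hR])
      exact Set.mem_iUnion.2 ⟨k, Or.inl ⟨hs, hk⟩⟩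
    · exact Set.mem_iUnion.2 ⟨0, Or.inr ⟨hs, by simp [hq', hR]⟩⟩
  obtain ⟨k, hk⟩ := h₁.exists_of_iUnion fun k l hkl =>
    relSet_mono fun q' _ hq' => attr_mono _ hkl hq'
  have := (h i q).2 ⟨k + 1, hk⟩
  simp [hq, hR] at this

theorem IsSolution.accepts [Fintype Q] (hw : ∀ q q', M.SameSCC q q' → (q ∈ M.R ↔ q' ∈ M.R))
    {u : ℕ → A} {Z : ℕ → Set Q} (h : M.IsSolution u Z) {i : ℕ} {q : Q} (hq : q ∈ Z i) :
    M.Accepts u i q := by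
  classical
  -- Leaving a component lowers the height. Inside a non-recurring component the round of attraction
  -- drops; inside a recurring one no decrease is required, so the second entry is constant.
  let μ : ℕ → Q → ℕ ×ₗ ℕ := fun i q =>
    toLex (M.height q, if q ∈ M.R then 0 else sInf {k | q ∈ M.attr u Z k i})
  have hN : ∀ i, ∀ q ∈ Z i, q ∉ M.R →
      (M.δ q).Sat (u i) {q' | q' ∈ Z (i + 1) ∧ μ (i + 1) q' < μ i q} := by
    intro i q hq hR
    have hk : sInf {k | q ∈ M.attr u Z k i} ∈ {k | q ∈ M.attr u Z k i} :=
      Nat.sInf_mem ((h i q).1 (by simp [hq, hR]))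
    have hμ : μ i q = toLex (M.height q, sInf {k | q ∈ M.attr u Z k i}) := by simp [μ, hR]
    rw [hμ]
    generalize sInf {k | q ∈ M.attr u Z k i} = k at *
    rcases k with - | k
    · exact hk.elim
    · replace hk : (M.polarized q).Sat (u i) _ := hk
      rw [polarized_of_notMem hR] at hk
      refine hk.mono_of_next_mem fun q' he hq' => ?_
      rcases hq' with ⟨hs, hq'⟩ | ⟨hs, hq'⟩
      · have hR' : q' ∉ M.R := by rwa [← hw q q' hs]
        refine ⟨((h (i + 1) q').2 ⟨k, hq'⟩).2 hR', ?_⟩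
        rw [Prod.Lex.toLex_lt_toLex']
        refine ⟨height_le he, fun _ => ?_⟩
        simp only [hR', if_false]
        exact Nat.lt_succ_of_le (Nat.sInf_le hq')
      · exact ⟨hq'.2 hR, Prod.Lex.toLex_lt_toLex.2 (Or.inl (height_lt he hs))⟩
  refine accepts_of_measure (X := Z) (μ := μ) (fun i q hq => ?_) hN hq
  by_cases hR : q ∈ M.R
  · refine (h.sat hw hq hR).mono_of_next_mem fun q' he hq' => ⟨hq', ?_⟩
    by_cases hs : M.SameSCC q q'
    · have hR' := (hw q q' hs).1 hR
      rw [Prod.Lex.toLex_le_toLex']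
      exact ⟨height_le he, fun _ => by simp [hR']⟩
    · exact (Prod.Lex.toLex_lt_toLex.2 (Or.inl (height_lt he hs))).le
  · exact (hN i q hq hR).mono fun q' hq' => ⟨hq'.1, hq'.2.le⟩

/-- `IsSolution.accepts` serves `M` on `Z` and the dual on the complement; disjointness turns the
two inclusions into equality. -/
theorem IsSolution.eq_computed [Fintype Q] (hM : M.IsWeak) {u : ℕ → A} {Z : ℕ → Set Q}
    (h : M.IsSolution u Z) : Z = M.computed u := by
  funext i
  refine Set.Subset.antisymm (fun q hq => h.accepts (fun _ _ => hM.mem_R_iff) hq) fun q hq => ?_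
  by_contra hn
  refine not_accepts_dual hq (h.dual.accepts (fun q q' hs => ?_) (i := i) (q := q) hn)
  exact not_congr (hM.mem_R_iff (sameSCC_dual.1 hs))

/-- The stages consult `Z` only across edges that leave the component, hence at strictly smaller
height. -/
theorem attr_congr [Fintype Q] {u : ℕ → A} {Z Z' : ℕ → Set Q} {n : ℕ}
    (h : ∀ i q, M.height q < n → (q ∈ Z i ↔ q ∈ Z' i)) (k i : ℕ) {q : Q} (hq : M.height q ≤ n) :
    q ∈ M.attr u Z k i ↔ q ∈ M.attr u Z' k i := by
  induction k generalizing i q with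
  | zero => rfl
  | succ k ih =>
    constructor <;> refine fun hs => TransCond.Sat.mono_of_next_mem hs fun q' he hq' => ?_ <;>
      rw [next_mem_polarized] at he <;> rcases hq' with ⟨hs, hq'⟩ | ⟨hs, hq'⟩
    · exact Or.inl ⟨hs, (ih _ ((height_le he).trans hq)).1 hq'⟩
    · exact Or.inr ⟨hs, by rw [← h _ _ ((height_lt he hs).trans_le hq)]; exact hq'⟩
    · exact Or.inl ⟨hs, (ih _ ((height_le he).trans hq)).2 hq'⟩
    · exact Or.inr ⟨hs, by rw [h _ _ ((height_lt he hs).trans_le hq)]; exact hq'⟩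

variable (M) in
theorem exists_isSolution [Fintype Q] (u : ℕ → A) : ∃ Z, M.IsSolution u Z := by
  suffices H : ∀ n, ∃ Z : ℕ → Set Q, ∀ i q, M.height q < n →
      ((q ∈ Z i ↔ q ∉ M.R) ↔ ∃ k, q ∈ M.attr u Z k i) by
    obtain ⟨Z, hZ⟩ := H (Fintype.card Q + 1)
    exact ⟨Z, fun i q => hZ i q (Nat.lt_succ_of_le (Finset.card_le_univ _))⟩
  intro n
  induction n with
  | zero => exact ⟨fun _ => ∅, by simp⟩
  | succ n ih =>
    obtain ⟨Z, hZ⟩ := ih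
    -- The new clause solves the equation at height `n`; its values at greater heights are
    -- provisional.
    let Z' : ℕ → Set Q := fun i =>
      {q | (M.height q < n ∧ q ∈ Z i) ∨
        (¬ M.height q < n ∧ (q ∉ M.R ↔ ∃ k, q ∈ M.attr u Z k i))}
    have hZ' : ∀ i q, M.height q < n → (q ∈ Z i ↔ q ∈ Z' i) := by
      intro i q hq
      simp [Z', hq]
    refine ⟨Z', fun i q hq => ?_⟩
    simp only [← attr_congr hZ' _ i (Nat.le_of_lt_succ hq)]
    by_cases hn : M.height q < n
    · rw [← hZ' i q hn, hZ i q hn]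
    · have : q ∈ Z' i ↔ (q ∉ M.R ↔ ∃ k, q ∈ M.attr u Z k i) := by
        simp only [Z', Set.mem_ofPred_eq]
        tauto
      rw [this]
      tauto

end Attractor

end AlternatingAutomaton

namespace AlternatingAutomaton

variable {A Q : Type*} [Fintype Q] {M : AlternatingAutomaton A Q}

theorem mem_scc {q q' : Q} : q' ∈ M.scc q ↔ M.SameSCC q q' := by
  simp [scc]

theorem SameSCC.scc_eq {q q' : Q} (h : M.SameSCC q q') : M.scc q = M.scc q' := by
  ext x
  rw [mem_scc, mem_scc, h.congr_left]

/-! ### Ranks within a component. -/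

section LevelIndex

open Classical

variable (M) in
/-- The position of the value `f q` among the nontrivial values of `f` on the strongly connected
component of `q`; the position of `⊥` is zero. -/
noncomputable def levelIndex {L : Type*} [PartialOrder L] [OrderBot L] (f : Q → L) (q : Q) : ℕ :=
  (((M.scc q).filter fun x => f x ≠ ⊥ ∧ f x ≤ f q).image
    fun x => (M.scc q).filter fun y => f y ≤ f x).card

variable {L L' : Type*} [PartialOrder L] [OrderBot L] [PartialOrder L'] [OrderBot L']

theorem levelIndex_le_card (f : Q → L) (q : Q) : M.levelIndex f q ≤ (M.scc q).card :=
  Finset.card_image_le.trans (Finset.card_filter_le _ _)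

theorem levelIndex_eq_zero {f : Q → L} {q : Q} : M.levelIndex f q = 0 ↔ f q = ⊥ := by
  rw [levelIndex, Finset.card_eq_zero, Finset.image_eq_empty, Finset.filter_eq_empty_iff]
  constructor
  · intro h
    by_contra hq
    exact h (mem_scc.2 (.refl M q)) ⟨hq, le_rfl⟩
  · rintro h x - ⟨h₁, h₂⟩
    exact h₁ (le_bot_iff.1 (h ▸ h₂))

theorem levelIndex_le_iff {f : Q → L} {x y : Q} (hs : M.SameSCC x y) (ht : f x ≤ f y ∨ f y ≤ f x) :
    M.levelIndex f x ≤ M.levelIndex f y ↔ f x ≤ f y := by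
  have mono : ∀ {x y}, M.SameSCC x y → f x ≤ f y → M.levelIndex f x ≤ M.levelIndex f y := by
    intro x y hs h
    rw [levelIndex, levelIndex, hs.scc_eq]
    exact Finset.card_le_card (Finset.image_subset_image
      (Finset.monotone_filter_right _ fun z _ hz => ⟨hz.1, hz.2.trans h⟩))
  refine ⟨fun h => ?_, mono hs⟩
  by_contra hn
  have hyx : f y ≤ f x := ht.resolve_left hn
  refine h.not_gt ?_
  rw [levelIndex, levelIndex, hs.scc_eq]
  refine Finset.card_lt_card ⟨Finset.image_subset_image
    (Finset.monotone_filter_right _ fun z _ hz => ⟨hz.1, hz.2.trans hyx⟩), fun hsub => ?_⟩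
  -- The lower set of `x` is counted for `x` but not for `y`: if some `z` with `f z ≤ f y` had the
  -- same lower set, then `f x ≤ f z ≤ f y`.
  obtain ⟨z, hz, hzx⟩ := Finset.mem_image.1 (hsub (Finset.mem_image_of_mem _ (Finset.mem_filter.2
    ⟨mem_scc.2 hs.symm, fun h0 => hn (h0 ▸ bot_le), le_rfl⟩)))
  have : x ∈ (M.scc y).filter fun w => f w ≤ f z := by
    rw [hzx]
    exact Finset.mem_filter.2 ⟨mem_scc.2 hs.symm, le_rfl⟩
  exact hn ((Finset.mem_filter.1 this).2.trans (Finset.mem_filter.1 hz).2.2)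

/-- Ranks depend only on the order and on the bottom value, so numerical raw levels can be compared
with sets of attraction times. -/
theorem levelIndex_congr {f : Q → L} {g : Q → L'} {q : Q}
    (hle : ∀ x y, M.SameSCC q x → M.SameSCC q y → (f x ≤ f y ↔ g x ≤ g y))
    (hbot : ∀ x, M.SameSCC q x → (f x = ⊥ ↔ g x = ⊥)) : M.levelIndex f q = M.levelIndex g q := by
  have h : ((M.scc q).filter fun x => f x ≠ ⊥ ∧ f x ≤ f q) =
      (M.scc q).filter fun x => g x ≠ ⊥ ∧ g x ≤ g q := by
    refine Finset.filter_congr fun x hx => ?_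
    rw [mem_scc] at hx
    rw [ne_eq, hbot x hx, hle x q hx (.refl M q)]
  rw [levelIndex, levelIndex, h]
  refine congrArg Finset.card (Finset.image_congr fun x hx => ?_)
  refine Finset.filter_congr fun y hy => ?_
  exact hle y x (mem_scc.1 hy) (mem_scc.1 (Finset.mem_filter.1 hx).1)

/-- There are at most `f q` positive values up to `f q`. Closing gaps therefore never raises a
level. -/
theorem levelIndex_le_self (f : Q → ℕ) (q : Q) : M.levelIndex f q ≤ f q := by
  have : (((M.scc q).filter fun x => f x ≠ ⊥ ∧ f x ≤ f q).image
      fun x => (M.scc q).filter fun y => f y ≤ f x) ⊆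
      (Finset.Icc 1 (f q)).image fun t => (M.scc q).filter fun y => f y ≤ t := by
    intro S hS
    obtain ⟨x, hx, rfl⟩ := Finset.mem_image.1 hS
    obtain ⟨-, h0, hle⟩ := Finset.mem_filter.1 hx
    exact Finset.mem_image.2 ⟨f x, Finset.mem_Icc.2 ⟨Nat.one_le_iff_ne_zero.2 h0, hle⟩, rfl⟩
  rw [levelIndex]
  have h := (Finset.card_le_card this).trans Finset.card_image_le
  rw [Nat.card_Icc, Nat.add_sub_cancel] at h
  convert h
  rfl

end LevelIndex

/-! ### One backward step on levels. -/

section RawLevel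

open Classical in
variable (M) in
/-- The largest threshold `t` such that the states of level at least `t` suffice for `q` to leave
its default status. -/
noncomputable def rawLevel (a : A) (p : Q → ℕ) (q : Q) : ℕ :=
  Nat.findGreatest
    (fun t => (M.polarized q).Sat a (M.relSet q (M.decode p) {x | t ≤ p x})) ((M.scc q).card + 1)

theorem rawLevel_le (a : A) (p : Q → ℕ) (q : Q) : M.rawLevel a p q ≤ (M.scc q).card + 1 := by
  classical exact Nat.findGreatest_le _

open Classical in
theorem le_rawLevel_iff {a : A} {p : Q → ℕ} {q : Q} {t : ℕ} (h₁ : 1 ≤ t)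
    (h₂ : t ≤ (M.scc q).card + 1) : t ≤ M.rawLevel a p q ↔
      (M.polarized q).Sat a (M.relSet q (M.decode p) {x | t ≤ p x}) := by
  refine ⟨fun h => ?_, fun h => Nat.le_findGreatest h₂ h⟩
  have := Nat.findGreatest_of_ne_zero (m := M.rawLevel a p q) rfl (by omega)
  exact this.mono (relSet_mono fun x _ hx => h.trans hx)

/-- If no state of the component had exactly this level, the next threshold would define the same
upper set and also suffice. The bound `card + 1` in the search leaves room for that threshold. -/
theorem exists_eq_rawLevel {a : A} {p : Q → ℕ} {q : Q} (h₁ : 1 ≤ M.rawLevel a p q)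
    (h₂ : M.rawLevel a p q ≤ (M.scc q).card) :
    ∃ x, M.SameSCC q x ∧ p x = M.rawLevel a p q := by
  by_contra! h
  refine Nat.not_succ_le_self (M.rawLevel a p q)
    ((le_rawLevel_iff (by omega) (by omega)).2 ?_)
  refine ((le_rawLevel_iff h₁ (by omega)).1 le_rfl).mono (relSet_mono fun x hx hx' => ?_)
  exact lt_of_le_of_ne hx' (h x hx).symm

/-- The link between stages and levels: a stage cut out by threshold `t` on levels at `i + 1` has as
successor the stage cut out by the same `t` on raw levels at `i`. -/
theorem mem_attr_succ_iff {u : ℕ → A} {Z : ℕ → Set Q} {p : Q → ℕ} {i k t : ℕ} {q : Q}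
    (hp : M.decode p = Z (i + 1)) (h₁ : 1 ≤ t) (h₂ : t ≤ (M.scc q).card + 1)
    (h : ∀ x, M.SameSCC q x → (x ∈ M.attr u Z k (i + 1) ↔ t ≤ p x)) :
    q ∈ M.attr u Z (k + 1) i ↔ t ≤ M.rawLevel (u i) p q := by
  rw [le_rawLevel_iff h₁ h₂, hp]
  exact ⟨fun hs => TransCond.Sat.mono hs (relSet_mono fun x hx => (h x hx).1),
    fun hs => TransCond.Sat.mono hs (relSet_mono fun x hx => (h x hx).2)⟩

theorem exists_threshold {p : Q → ℕ} {q : Q} (hp : ∀ x, M.SameSCC q x → p x ≤ (M.scc q).card)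
    {U : Set Q} (hpos : ∀ x, M.SameSCC q x → x ∈ U → 1 ≤ p x)
    (hU : ∀ x y, M.SameSCC q x → M.SameSCC q y → p x ≤ p y → x ∈ U → y ∈ U) :
    ∃ t, 1 ≤ t ∧ t ≤ (M.scc q).card + 1 ∧ ∀ x, M.SameSCC q x → (x ∈ U ↔ t ≤ p x) := by
  classical
  rcases ((M.scc q).filter (· ∈ U)).eq_empty_or_nonempty with h | h
  · refine ⟨(M.scc q).card + 1, by omega, le_rfl, fun x hx => ⟨fun hxU => ?_, fun h' => ?_⟩⟩
    · exact ((Finset.filter_eq_empty_iff.1 h) (mem_scc.2 hx) hxU).elim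
    · have := hp x hx
      omega
  · obtain ⟨x, hx, hmin⟩ := Finset.exists_min_image _ p h
    simp only [Finset.mem_filter, mem_scc] at hx hmin
    refine ⟨p x, hpos x hx.1 hx.2, (hp x hx.1).trans (Nat.le_succ _), fun y hy => ?_⟩
    exact ⟨fun hyU => hmin y ⟨hy, hyU⟩, fun hxy => hU x y hx.1 hy hxy hx.2⟩

end RawLevel

/-! ### Final level runs: correctness, uniqueness, existence. -/

section LevelRun

variable (M) in
/-- A final run, as a sequence of assignments of levels. -/
structure IsLevelRun (u : ℕ → A) (p : ℕ → Q → ℕ) : Prop where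
  step : ∀ i, p i = M.levelIndex (M.rawLevel (u i) (p (i + 1)))
  final : ∀ q c, 1 ≤ c → c ≤ (M.scc q).card →
    {i | ¬ ∃ x, M.SameSCC q x ∧ p i x = c ∧ M.rawLevel (u i) (p (i + 1)) x = c}.Infinite

variable {u : ℕ → A} {p : ℕ → Q → ℕ}

theorem le_iff_rawLevel_le (hp : ∀ i, p i = M.levelIndex (M.rawLevel (u i) (p (i + 1)))) {i : ℕ}
    {x y : Q} (hs : M.SameSCC x y) :
    p i x ≤ p i y ↔ M.rawLevel (u i) (p (i + 1)) x ≤ M.rawLevel (u i) (p (i + 1)) y := by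
  rw [hp i]
  exact levelIndex_le_iff hs (le_total _ _)

theorem eq_zero_iff_rawLevel (hp : ∀ i, p i = M.levelIndex (M.rawLevel (u i) (p (i + 1)))) {i : ℕ}
    {x : Q} : p i x = 0 ↔ M.rawLevel (u i) (p (i + 1)) x = 0 := by
  rw [hp i]
  exact levelIndex_eq_zero

theorem level_le_card (hp : ∀ i, p i = M.levelIndex (M.rawLevel (u i) (p (i + 1)))) (i : ℕ)
    {q x : Q} (hs : M.SameSCC q x) : p i x ≤ (M.scc q).card := by
  rw [hp i, hs.scc_eq]
  exact levelIndex_le_card _ _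

/-- Every stage is an upper set for the levels, because normalizing preserves the order of raw
levels. Finality plays no role here. -/
theorem attr_threshold (hp : ∀ i, p i = M.levelIndex (M.rawLevel (u i) (p (i + 1)))) (k i : ℕ)
    (q : Q) : ∃ t, 1 ≤ t ∧ t ≤ (M.scc q).card + 1 ∧ ∀ x, M.SameSCC q x →
      (x ∈ M.attr u (fun i => M.decode (p i)) k i ↔ t ≤ p i x) := by
  induction k generalizing i with
  | zero =>
    refine ⟨(M.scc q).card + 1, by omega, le_rfl, fun x hx => ⟨fun h => h.elim, fun h => ?_⟩⟩
    have := level_le_card hp i hx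
    omega
  | succ k ih =>
    obtain ⟨t, h₁, h₂, ht⟩ := ih (i + 1)
    have key : ∀ x, M.SameSCC q x → (x ∈ M.attr u (fun i => M.decode (p i)) (k + 1) i ↔
        t ≤ M.rawLevel (u i) (p (i + 1)) x) := fun x hx =>
      mem_attr_succ_iff rfl h₁ (hx.scc_eq ▸ h₂) fun y hy => ht y (hx.trans hy)
    refine exists_threshold (fun x hx => level_le_card hp i hx) (fun x hx hxU => ?_)
      fun x y hx hy hxy hxU => ?_
    · rw [key x hx] at hxU
      rw [Nat.one_le_iff_ne_zero, ne_eq, eq_zero_iff_rawLevel hp]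
      omega
    · rw [key x hx] at hxU
      rw [key y hy]
      exact hxU.trans ((le_iff_rawLevel_le hp (hx.symm.trans hy)).1 hxy)

/-- A false claim is passed on: raw level `card + 1` would mean leaving in round one, so the raw
level is carried by a state `x` at the next position, and attraction of `x` would attract `q` one
round later. -/
theorem exists_rawLevel_of_notMem_attr
    (hp : ∀ i, p i = M.levelIndex (M.rawLevel (u i) (p (i + 1)))) {i : ℕ} {q : Q}
    (h0 : p i q ≠ 0) (hq : ∀ k, q ∉ M.attr u (fun i => M.decode (p i)) k i) :
    ∃ x, M.SameSCC q x ∧ p (i + 1) x = M.rawLevel (u i) (p (i + 1)) q ∧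
      ∀ k, x ∉ M.attr u (fun i => M.decode (p i)) k (i + 1) := by
  have h₁ : 1 ≤ M.rawLevel (u i) (p (i + 1)) q := by
    rwa [Nat.one_le_iff_ne_zero, ne_eq, ← eq_zero_iff_rawLevel hp]
  have key := fun k t (h₁ : 1 ≤ t) h₂ h => mem_attr_succ_iff (M := M) (u := u) (i := i) (k := k)
    (t := t) (q := q) (Z := fun i => M.decode (p i)) rfl h₁ h₂ h
  have h₂ : M.rawLevel (u i) (p (i + 1)) q ≤ (M.scc q).card := by
    by_contra hn
    refine hq 1 ((key 0 ((M.scc q).card + 1) (by omega) le_rfl fun x hx =>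
      ⟨fun h => h.elim, fun h => ?_⟩).2 (by omega))
    have := level_le_card hp (i + 1) hx
    omega
  obtain ⟨x, hx, hpx⟩ := exists_eq_rawLevel h₁ h₂
  refine ⟨x, hx, hpx, fun k hk => ?_⟩
  obtain ⟨t, ht₁, ht₂, ht⟩ := attr_threshold hp k (i + 1) q
  exact hq (k + 1) ((key k t ht₁ ht₂ ht).2 (hpx ▸ (ht x hx).1 hk))

theorem IsLevelRun.isSolution (h : M.IsLevelRun u p) :
    M.IsSolution u fun i => M.decode (p i) := by
  have hp := h.step
  intro i₀ q₀
  rw [mem_decode_iff]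
  constructor
  · intro h0
    by_contra! hq₀
    let S : Set ℕ := {c | ∃ i q, M.SameSCC q₀ q ∧ p i q = c ∧ c ≠ 0 ∧
      ∀ k, q ∉ M.attr u (fun i => M.decode (p i)) k i}
    have hb : BddAbove S := by
      refine ⟨(M.scc q₀).card, ?_⟩
      rintro c ⟨i, q, hs, rfl, -⟩
      exact level_le_card hp i hs
    -- Let `c` be the greatest level of a false claim at any position. Its raw level is at least
    -- `c`, and is itself the level of a false claim one position later, hence equals `c`. So the
    -- claim persists forever.
    have hmem : sSup S ∈ S := Nat.sSup_mem ⟨p i₀ q₀, i₀, q₀, .refl M q₀, rfl, h0, hq₀⟩ hb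
    have hmax : ∀ c ∈ S, c ≤ sSup S := fun c hc => le_csSup hb hc
    generalize sSup S = c at hmem hmax
    obtain ⟨i, q, hs, hc, hc0, hq⟩ := hmem
    have step : ∀ i q, M.SameSCC q₀ q → p i q = c →
        (∀ k, q ∉ M.attr u (fun i => M.decode (p i)) k i) →
        M.rawLevel (u i) (p (i + 1)) q = c ∧ ∃ x, M.SameSCC q₀ x ∧ p (i + 1) x = c ∧
          ∀ k, x ∉ M.attr u (fun i => M.decode (p i)) k (i + 1) := by
      intro i q hs hc hq
      obtain ⟨x, hx, hpx, hxk⟩ := exists_rawLevel_of_notMem_attr hp (hc ▸ hc0) hq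
      have h₁ : c ≤ M.rawLevel (u i) (p (i + 1)) q := by
        rw [← hc, hp i]
        exact levelIndex_le_self _ _
      have h₂ := hmax _ ⟨i + 1, x, hs.trans hx, rfl, by omega, hxk⟩
      have h₃ : M.rawLevel (u i) (p (i + 1)) q = c := by omega
      exact ⟨h₃, x, hs.trans hx, by omega, hxk⟩
    have steps : ∀ d, ∃ q, M.SameSCC q₀ q ∧ p (i + d) q = c ∧
        ∀ k, q ∉ M.attr u (fun i => M.decode (p i)) k (i + d) := by
      intro d
      induction d with
      | zero => exact ⟨q, hs, hc, hq⟩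
      | succ d ih =>
        obtain ⟨x, hx, hxc, hxk⟩ := ih
        exact (step _ x hx hxc hxk).2
    obtain ⟨j, hj, hij⟩ := (h.final q₀ c (Nat.one_le_iff_ne_zero.2 hc0)
      (hc ▸ level_le_card hp i hs)).exists_gt i
    obtain ⟨d, rfl⟩ := Nat.exists_eq_add_of_le hij.le
    obtain ⟨x, hx, hxc, hxk⟩ := steps d
    exact hj ⟨x, hx, hxc, (step _ x hx hxc hxk).1⟩
  · rintro ⟨k, hk⟩
    obtain ⟨t, h₁, -, ht⟩ := attr_threshold hp k i₀ q₀
    have := (ht q₀ (.refl M q₀)).1 hk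
    omega

/-- Raw levels of `x` and `y` are realized by states `x'` and `y'` at the next position, where an
earlier stage separates them. The exceptions are immediate: raw level zero is never attracted, and
`card + 1` is attracted in round one. -/
theorem exists_attr_separating (hp : ∀ i, p i = M.levelIndex (M.rawLevel (u i) (p (i + 1))))
    {k i : ℕ} {x y : Q} (hs : M.SameSCC x y) (hlt : p i x < p i y)
    (hk : y ∈ M.attr u (fun i => M.decode (p i)) k i) :
    ∃ l, y ∈ M.attr u (fun i => M.decode (p i)) l i ∧
      x ∉ M.attr u (fun i => M.decode (p i)) l i := by
  induction k generalizing i x y with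
  | zero => exact hk.elim
  | succ k ih =>
    have hraw : M.rawLevel (u i) (p (i + 1)) x < M.rawLevel (u i) (p (i + 1)) y := by
      rw [← not_le, ← le_iff_rawLevel_le hp hs.symm]
      omega
    have key := fun k t (h₁ : 1 ≤ t) h₂
        (h : ∀ w, M.SameSCC x w → (w ∈ M.attr u (fun i => M.decode (p i)) k (i + 1) ↔
          t ≤ p (i + 1) w)) z (hz : M.SameSCC x z) =>
      mem_attr_succ_iff (M := M) (u := u) (i := i) (k := k)
      (t := t) (q := z) (Z := fun i => M.decode (p i)) rfl h₁ (hz.scc_eq ▸ h₂)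
      fun w hw => h w (hz.trans hw)
    rcases Nat.eq_zero_or_pos (M.rawLevel (u i) (p (i + 1)) x) with h0 | h0
    · obtain ⟨t, ht₁, ht₂, ht⟩ := attr_threshold hp k (i + 1) x
      refine ⟨k + 1, hk, fun hx => ?_⟩
      have := (key k t ht₁ ht₂ ht x (.refl M x)).1 hx
      omega
    · have hc := hs.scc_eq
      have hy := M.rawLevel_le (u i) (p (i + 1)) y
      obtain ⟨x', hx', hpx⟩ := exists_eq_rawLevel (M := M) h0 (by rw [hc]; omega)
      rcases hy.lt_or_eq with hy' | hy'
      · obtain ⟨y', hy', hpy⟩ := exists_eq_rawLevel (M := M) (p := p (i + 1)) (a := u i) (q := y)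
          (by omega) (by omega)
        obtain ⟨t, ht₁, ht₂, ht⟩ := attr_threshold hp k (i + 1) x
        have hyk := (key k t ht₁ ht₂ ht y hs).1 hk
        obtain ⟨l, hl, hl'⟩ := ih (hx'.symm.trans (hs.trans hy')) (by omega)
          ((ht y' (hs.trans hy')).2 (by omega))
        obtain ⟨t, ht₁, ht₂, ht⟩ := attr_threshold hp l (i + 1) x
        rw [ht y' (hs.trans hy')] at hl
        rw [ht x' hx'] at hl'
        refine ⟨l + 1, (key l t ht₁ ht₂ ht y hs).2 (by omega), fun hx => hl' ?_⟩
        have := (key l t ht₁ ht₂ ht x (.refl M x)).1 hx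
        omega
      · have h0 : ∀ z, M.SameSCC x z → (z ∈ M.attr u (fun i => M.decode (p i)) 0 (i + 1) ↔
            (M.scc x).card + 1 ≤ p (i + 1) z) := fun z hz =>
          ⟨fun h => h.elim, fun h => by have := level_le_card hp (i + 1) hz; omega⟩
        refine ⟨1, (key 0 _ (by omega) le_rfl h0 y hs).2 (by rw [hc]; omega), fun hx => ?_⟩
        have := (key 0 _ (by omega) le_rfl h0 x (.refl M x)).1 hx
        rw [hc] at this
        omega

theorem IsLevelRun.eq_levelIndex (h : M.IsLevelRun u p) (i : ℕ) :
    p i = M.levelIndex (M.attrTimes u (fun i => M.decode (p i)) i) := by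
  have hp := h.step
  have hpos : ∀ x, p i x ≠ 0 ↔ ∃ k, x ∈ M.attr u (fun i => M.decode (p i)) k i := fun x =>
    mem_decode_iff.symm.trans (h.isSolution i x)
  funext q
  conv_lhs => rw [hp i]
  refine levelIndex_congr (fun x y hx hy => ?_) fun x hx => ?_
  · rw [← le_iff_rawLevel_le hp (hx.symm.trans hy)]
    constructor
    · intro hxy k hk
      obtain ⟨t, -, -, ht⟩ := attr_threshold hp k i q
      exact (ht y hy).2 (((ht x hx).1 hk).trans hxy)
    · intro hsub
      by_contra! hlt
      obtain ⟨k, hk⟩ := (hpos x).1 (by omega)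
      obtain ⟨l, hl, hl'⟩ := exists_attr_separating hp (hy.symm.trans hx) hlt hk
      exact hl' (hsub hl)
  · rw [attrTimes_eq_bot, ← hpos, not_not, eq_zero_iff_rawLevel hp]
    rfl

theorem IsSolution.decode_levelIndex {Z : ℕ → Set Q} (h : M.IsSolution u Z) (i : ℕ) :
    M.decode (M.levelIndex (M.attrTimes u Z i)) = Z i := by
  ext q
  have := h i q
  rw [decode, Set.mem_ofPred_eq, ne_eq, levelIndex_eq_zero, attrTimes_eq_bot, not_not, ← this]
  tauto

theorem exists_threshold_of_attr {Z : ℕ → Set Q} (k i : ℕ) (q : Q) :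
    ∃ t, 1 ≤ t ∧ t ≤ (M.scc q).card + 1 ∧ ∀ x, M.SameSCC q x →
      (x ∈ M.attr u Z k i ↔ t ≤ M.levelIndex (M.attrTimes u Z i) x) := by
  refine exists_threshold (fun x hx => hx.scc_eq ▸ levelIndex_le_card _ _) (fun x hx hk => ?_)
    fun x y hx hy hxy hk => ?_
  · rw [Nat.one_le_iff_ne_zero, ne_eq, levelIndex_eq_zero, attrTimes_eq_bot, not_not]
    exact ⟨k, hk⟩
  · exact (levelIndex_le_iff (hx.symm.trans hy) (attrTimes_total _ _ _ _ _)).1 hxy hk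

/-- The round is the first one that attracts the lowest state meeting the threshold. -/
theorem exists_attr_of_threshold {Z : ℕ → Set Q} {t : ℕ} (ht : 1 ≤ t) (i : ℕ) (q : Q) :
    ∃ k, ∀ x, M.SameSCC q x →
      (x ∈ M.attr u Z k i ↔ t ≤ M.levelIndex (M.attrTimes u Z i) x) := by
  classical
  rcases ((M.scc q).filter (t ≤ M.levelIndex (M.attrTimes u Z i) ·)).eq_empty_or_nonempty with
    h | h
  · refine ⟨0, fun x hx => ⟨fun h => h.elim, fun h' => ?_⟩⟩
    exact ((Finset.filter_eq_empty_iff.1 h) (mem_scc.2 hx) h').elim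
  · obtain ⟨x, hx, hmin⟩ := Finset.exists_min_image _ (M.levelIndex (M.attrTimes u Z i)) h
    simp only [Finset.mem_filter, mem_scc] at hx hmin
    have hne : ∃ k, x ∈ M.attr u Z k i := by
      rw [← not_not (a := ∃ k, _), ← attrTimes_eq_bot, ← levelIndex_eq_zero (M := M)]
      omega
    refine ⟨Nat.find hne, fun y hy => ⟨fun hk => hx.2.trans ?_, fun hty => ?_⟩⟩
    · refine (levelIndex_le_iff (hx.1.symm.trans hy) (attrTimes_total _ _ _ _ _)).2 fun l hl => ?_
      exact attr_mono i (Nat.find_min' hne hl) hk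
    · exact (levelIndex_le_iff (hx.1.symm.trans hy) (attrTimes_total _ _ _ _ _)).1
        (hmin y ⟨hy, hty⟩) (Nat.find_spec hne)

theorem IsSolution.isLevelRun {Z : ℕ → Set Q} (h : M.IsSolution u Z) :
    M.IsLevelRun u fun i => M.levelIndex (M.attrTimes u Z i) := by
  have key := fun (i k t : ℕ) (q : Q) (h₁ : 1 ≤ t) h₂
      (h' : ∀ w, M.SameSCC q w → (w ∈ M.attr u Z k (i + 1) ↔
        t ≤ M.levelIndex (M.attrTimes u Z (i + 1)) w)) x (hx : M.SameSCC q x) =>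
    mem_attr_succ_iff (M := M) (u := u) (i := i) (k := k)
      (t := t) (q := x) (Z := Z) (h.decode_levelIndex (i + 1)) h₁ (hx.scc_eq ▸ h₂)
      fun w hw => h' w (hx.trans hw)
  have fwd : ∀ i q x, M.SameSCC q x → ∀ k, x ∈ M.attr u Z k i → ∃ t, 1 ≤ t ∧ ∀ y, M.SameSCC q y →
      (y ∈ M.attr u Z k i ↔
        t ≤ M.rawLevel (u i) (M.levelIndex (M.attrTimes u Z (i + 1))) y) := by
    intro i q x hx k hk
    rcases k with - | k
    · exact hk.elim
    · obtain ⟨t, h₁, h₂, ht⟩ := exists_threshold_of_attr (M := M) (u := u) (Z := Z) k (i + 1) q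
      exact ⟨t, h₁, key i k t q h₁ h₂ ht⟩
  have bwd : ∀ i q x, M.SameSCC q x →
      1 ≤ M.rawLevel (u i) (M.levelIndex (M.attrTimes u Z (i + 1))) x →
      ∃ k, ∀ y, M.SameSCC q y → (y ∈ M.attr u Z k i ↔
        M.rawLevel (u i) (M.levelIndex (M.attrTimes u Z (i + 1))) x ≤
        M.rawLevel (u i) (M.levelIndex (M.attrTimes u Z (i + 1))) y) := by
    intro i q x hx h₁
    obtain ⟨k, hk⟩ := exists_attr_of_threshold (M := M) (u := u) (Z := Z) h₁ (i + 1) q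
    exact ⟨k + 1, key i k _ q h₁ (hx.scc_eq ▸ rawLevel_le _ _ _) hk⟩
  refine ⟨fun i => funext fun q => levelIndex_congr (fun x y hx hy => ⟨fun hsub => ?_, ?_⟩)
    fun x hx => ?_, fun q c h₁ h₂ => ?_⟩
  · rcases Nat.eq_zero_or_pos
      (M.rawLevel (u i) (M.levelIndex (M.attrTimes u Z (i + 1))) x) with h0 | h0
    · omega
    · obtain ⟨k, hk⟩ := bwd i q x hx h0
      exact (hk y hy).1 (hsub ((hk x hx).2 le_rfl))
  · intro hle k hk
    obtain ⟨t, -, ht⟩ := fwd i q x hx k hk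
    exact (ht y hy).2 (((ht x hx).1 hk).trans hle)
  · rw [attrTimes_eq_bot, not_iff_comm, bot_eq_zero]
    constructor
    · intro h0
      obtain ⟨k, hk⟩ := bwd i q x hx (Nat.one_le_iff_ne_zero.2 h0)
      exact ⟨k, (hk x hx).2 le_rfl⟩
    · rintro ⟨k, hk⟩
      obtain ⟨t, h₁, ht⟩ := fwd i q x hx k hk
      have := (ht x hx).1 hk
      omega
  -- If level `c` persisted from some position on, induction on `k` would show that no state of
  -- level `c` is attracted within `k` rounds: attraction at `k + 1` passes, through a state of raw
  -- level `c`, to level `c` at the next position. But a positive true level means attraction.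
  · intro hfin
    obtain ⟨n, hn⟩ := hfin.bddAbove
    have hbad : ∀ i, n < i → ∃ x, M.SameSCC q x ∧ M.levelIndex (M.attrTimes u Z i) x = c ∧
        M.rawLevel (u i) (M.levelIndex (M.attrTimes u Z (i + 1))) x = c := by
      intro i hi
      by_contra hc
      exact absurd (hn hc) (by omega)
    have hno : ∀ k i, n < i → ∀ x, M.SameSCC q x → M.levelIndex (M.attrTimes u Z i) x = c →
        x ∉ M.attr u Z k i := by
      intro k
      induction k with
      | zero => exact fun _ _ _ _ _ h => h
      | succ k ih =>
        intro i hi x hx hxc hk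
        obtain ⟨y, hy, hyc, hyr⟩ := hbad i hi
        obtain ⟨z, hz, hzc, -⟩ := hbad (i + 1) (by omega)
        obtain ⟨t, ht₁, ht₂, ht⟩ :=
          exists_threshold_of_attr (M := M) (u := u) (Z := Z) k (i + 1) q
        have hyk : y ∈ M.attr u Z (k + 1) i :=
          show k + 1 ∈ M.attrTimes u Z i y from
          (levelIndex_le_iff (hx.symm.trans hy) (attrTimes_total u Z i x y)).1
            (hxc.trans hyc.symm).le (show k + 1 ∈ M.attrTimes u Z i x from hk)
        rw [key i k t q ht₁ ht₂ ht y hy, hyr] at hyk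
        exact ih (i + 1) (by omega) z hz hzc ((ht z hz).2 (hzc ▸ hyk))
    obtain ⟨x, hx, hxc, -⟩ := hbad (n + 1) (by omega)
    have hne : M.levelIndex (M.attrTimes u Z (n + 1)) x ≠ 0 := by omega
    rw [ne_eq, levelIndex_eq_zero, attrTimes_eq_bot, not_not] at hne
    obtain ⟨k, hk⟩ := hne
    exact hno k _ (by omega) x hx hxc hk

/-- There is exactly one final level run, and it encodes the accepted states. -/
theorem IsWeak.isLevelRun_iff (hM : M.IsWeak) (u : ℕ → A) (p : ℕ → Q → ℕ) :
    M.IsLevelRun u p ↔ p = fun i => M.levelIndex (M.attrTimes u (M.computed u) i) := by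
  constructor
  · intro h
    have hZ := h.isSolution.eq_computed hM
    funext i
    rw [← hZ]
    exact h.eq_levelIndex i
  · rintro rfl
    obtain ⟨Z, hZ⟩ := M.exists_isSolution u
    rw [← hZ.eq_computed hM]
    exact hZ.isLevelRun

theorem IsLevelRun.decode_eq (hM : M.IsWeak) (h : M.IsLevelRun u p) (i : ℕ) :
    M.decode (p i) = M.computed u i :=
  congrFun (h.isSolution.eq_computed hM) i

end LevelRun

end AlternatingAutomaton

/-! ### The level automaton and its size. -/

namespace AlternatingAutomaton

variable {A Q : Type*}

section Enumeration

open Classical in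
/-- The position, starting from one, of an element in an enumeration of a finite set. -/
noncomputable def enumIndex (S : Finset Q) (q : Q) : ℕ :=
  if h : q ∈ S then (S.equivFin ⟨q, h⟩ : ℕ) + 1 else 0

theorem exists_enumIndex_eq (S : Finset Q) {c : ℕ} (h₁ : 1 ≤ c) (h₂ : c ≤ S.card) :
    ∃ q ∈ S, enumIndex S q = c := by
  obtain ⟨⟨q, hq⟩, hx⟩ := S.equivFin.surjective ⟨c - 1, by omega⟩
  refine ⟨q, hq, ?_⟩
  rw [enumIndex, dif_pos hq, hx]
  exact Nat.sub_add_cancel h₁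

theorem enumIndex_pos {S : Finset Q} {q : Q} (h : q ∈ S) : 1 ≤ enumIndex S q := by
  rw [enumIndex, dif_pos h]
  omega

theorem enumIndex_le_card {S : Finset Q} {q : Q} (h : q ∈ S) : enumIndex S q ≤ S.card := by
  rw [enumIndex, dif_pos h]
  exact (S.equivFin ⟨q, h⟩).2

end Enumeration

variable [Fintype Q] (M : AlternatingAutomaton A Q)

/-- The assignments of levels whose values are bounded by the sizes of the strongly connected
components. -/
abbrev LevelState : Type _ := ∀ q, Fin ((M.scc q).card + 1)

open Classical in
theorem card_levelState : Nat.card M.LevelState = ∏ S ∈ M.sccs, (S.card + 1) ^ S.card := by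
  simp only [LevelState, Nat.card_pi, Nat.card_fin]
  -- Group the factors by component; the fibre of `M.scc` over a component is the component itself.
  rw [Finset.prod_comp (fun S : Finset Q => S.card + 1) M.scc]
  refine Finset.prod_congr rfl fun S hS => ?_
  obtain ⟨q, -, rfl⟩ := Finset.mem_image.1 hS
  congr 2
  ext x
  simp only [Finset.mem_filter, Finset.mem_univ, true_and, mem_scc]
  refine ⟨fun h => ?_, fun h => h.scc_eq.symm⟩
  rw [← mem_scc, ← h, mem_scc]
  exact .refl M x

/-- The levels of a state of the level automaton. -/
def LevelState.val {M : AlternatingAutomaton A Q} (s : M.LevelState) (q : Q) : ℕ := s q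

theorem LevelState.val_injective {M : AlternatingAutomaton A Q} :
    Function.Injective (LevelState.val (M := M)) :=
  fun _ _ h => funext fun q => Fin.ext (congrFun h q)

/-- The backward transition function on levels. -/
noncomputable def levelStep (a : A) (s : M.LevelState) : M.LevelState := fun q =>
  ⟨M.levelIndex (M.rawLevel a s.val) q, Nat.lt_succ_of_le (levelIndex_le_card _ _)⟩

/-- The backward automaton on levels, with states named by an equivalent type; each state `q` of
`M` contributes one Büchi set, which excludes the persistence of one level of its component. -/
noncomputable def levelAutomaton {P : Type*} (e : M.LevelState ≃ P) : BackwardGTBAutomaton A P where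
  ρ a s := e (M.levelStep a (e.symm s))
  numBuchi := Fintype.card Q
  buchi j := {t | t.1 = e (M.levelStep t.2.1 (e.symm t.2.2)) ∧
    ¬ ∃ x, M.SameSCC ((Fintype.equivFin Q).symm j) x ∧
      (e.symm t.1).val x =
        enumIndex (M.scc ((Fintype.equivFin Q).symm j)) ((Fintype.equivFin Q).symm j) ∧
      M.rawLevel t.2.1 (e.symm t.2.2).val x =
        enumIndex (M.scc ((Fintype.equivFin Q).symm j)) ((Fintype.equivFin Q).symm j)}
  buchi_transition _ _ _ _ h := h.1

variable {M}

theorem isFinalRun_levelAutomaton_iff {P : Type*} {e : M.LevelState ≃ P} {u : ℕ → A} {r : ℕ → P} :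
    (M.levelAutomaton e).IsFinalRun u r ↔ M.IsLevelRun u fun i => (e.symm (r i)).val := by
  have hrun : (M.levelAutomaton e).IsRun u r ↔ ∀ i, (e.symm (r i)).val =
      M.levelIndex (M.rawLevel (u i) (e.symm (r (i + 1))).val) := by
    refine forall_congr' fun i => ?_
    change r i = e _ ↔ _
    rw [← e.symm_apply_eq, ← LevelState.val_injective.eq_iff]
    rfl
  constructor
  · rintro ⟨h, hb⟩
    refine ⟨hrun.1 h, fun q c h₁ h₂ => ?_⟩
    -- The Büchi set for level `c` of this component is the one indexed by its `c`-th state.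
    obtain ⟨x, hx, rfl⟩ := exists_enumIndex_eq (M.scc q) h₁ h₂
    rw [mem_scc] at hx
    refine (hb (Fintype.equivFin Q x)).mono fun i hi => ?_
    have := hi.2
    rw [Equiv.symm_apply_apply, ← hx.scc_eq] at this
    rintro ⟨y, hy, h⟩
    exact this ⟨y, hx.symm.trans hy, h⟩
  · intro h
    refine ⟨hrun.2 h.step, fun j => ?_⟩
    have hj : (Fintype.equivFin Q).symm j ∈ M.scc ((Fintype.equivFin Q).symm j) :=
      mem_scc.2 (.refl M _)
    refine (h.final _ _ (enumIndex_pos hj) (enumIndex_le_card hj)).mono fun i hi => ⟨?_, hi⟩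
    exact hrun.2 h.step i

theorem IsWeak.existsUnique_finalRun (hM : M.IsWeak) {P : Type*} (e : M.LevelState ≃ P)
    (u : ℕ → A) : ∃! r : ℕ → P, (M.levelAutomaton e).IsFinalRun u r := by
  simp only [isFinalRun_levelAutomaton_iff, hM.isLevelRun_iff]
  refine ⟨fun i => e fun q => ⟨M.levelIndex (M.attrTimes u (M.computed u) i) q,
    Nat.lt_succ_of_le (levelIndex_le_card _ _)⟩, ?_, fun r hr => ?_⟩
  · simp only [Equiv.symm_apply_apply]
    rfl
  · funext i
    rw [← e.symm_apply_eq]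
    exact LevelState.val_injective (congrFun hr i)

theorem card_levelState_le : Nat.card M.LevelState ≤
    (Fintype.card Q + 1) ^ Fintype.card Q := by
  simp only [LevelState, Nat.card_pi, Nat.card_fin]
  refine (Finset.prod_le_pow_card _ _ (Fintype.card Q + 1) fun q _ => ?_).trans_eq rfl
  exact Nat.succ_le_succ (Finset.card_le_univ _)

theorem IsVeryWeak.card_levelState_eq (hM : M.IsVeryWeak) :
    Nat.card M.LevelState = 2 ^ Fintype.card Q := by
  classical
  have h : ∀ q, (M.scc q).card = 1 := fun q =>
    hM _ (Finset.mem_image_of_mem _ (Finset.mem_univ q))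
  simp [LevelState, h]

end AlternatingAutomaton

theorem mainTheorem1 {A : Type*} {Q : Type*} [Fintype Q] (M : AlternatingAutomaton A Q)
    (hM : M.IsWeak) :
    ∃ (P : Type) (_ : Fintype P) (B : BackwardDetGTBAutomaton A P) (out : P → Set Q),
      M.computed = B.computed out ∧
      Fintype.card P ≤ ∏ S ∈ M.sccs, (S.card + 1) ^ S.card ∧
      Fintype.card P ≤ (Fintype.card Q + 1) ^ Fintype.card Q ∧
      B.numBuchi = Fintype.card Q ∧
      (M.IsVeryWeak → Fintype.card P ≤ 2 ^ Fintype.card Q) := by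
  -- The level states live in the universe of `Q`; renaming them by `Fin` puts the state set in
  -- `Type`.
  let e := Finite.equivFin M.LevelState
  refine ⟨Fin (Nat.card M.LevelState), inferInstance,
    ⟨M.levelAutomaton e, hM.existsUnique_finalRun e⟩, fun s => M.decode (e.symm s).val,
    ?_, ?_, ?_, rfl, fun h => ?_⟩
  · funext u i
    have h := AlternatingAutomaton.isFinalRun_levelAutomaton_iff.1
      (hM.existsUnique_finalRun e u).choose_spec.1
    exact (h.decode_eq hM i).symm
  · rw [Fintype.card_fin, M.card_levelState]
  · rw [Fintype.card_fin]
    exact AlternatingAutomaton.card_levelState_le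
  · rw [Fintype.card_fin, h.card_levelState_eq]
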